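/- Let $\mathbb H_3^{\mathbb C}$ be the complex Heisenberg group of upper unipotent $3\times 3$ complex matrices with coordinates $(z_1,z_2,z_3)$, where $z_1,z_2$ are the $(1,2)$ and $(2,3)$ entries and $z_3$ is the $(1,3)$ entry, and let $M=\Gamma\backslash\mathbb H_3^{\mathbb C}$, $\Gamma=\mathbb H_3^{\mathbb C}\cap \mathrm{SL}(3,\mathbb Z[i])$, be the Iwasawa manifold. Let $\phi^1=dz_1$, $\phi^2=dz_2$, $\phi^3=dz_3-z_1\,dz_2$ and $\phi^{\bar j}=\overline{\phi^j}$. For complex-valued functions $q,r\in C^\infty(M)$, let $J_{q,r}$ be the almost complex structure on $M$ whose $(1,0)$-forms are spanned by the coframe $$\omega^1=\phi^1,\qquad \omega^2=\phi^2,\qquad \omega^3=\phi^3+q\,\phi^{\bar 1}+r\,\phi^{\bar 2},$$ and put $\omega^{123}=\omega^1\wedge\omega^2\wedge\omega^3$. For an almost complex structure $J$ on $M$ let $K_J=\Lambda^{3,0}$ be its canonical bundle. On $(3,0)$-forms $\bar\partial$ is the $(3,1)$-component of $d$; it extends to sections of $K_J^{\otimes l}$ by the Leibniz rule. Let $P_l$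 be the complex vector space of smooth sections $s$ of $K_J^{\otimes l}$ over $M$ with $\bar\partial s=0$. The Kodaira dimension $\kappa_J$ is $-\infty$ if $P_l=\{0\}$ for all $l\ge 1$, and $\limsup_{l\to\infty}\frac{\log\dim_{\mathbb C}P_l}{\log l}$ otherwise. The bundle $K_J$ is pseudoholomorphically trivial if it has a nowhere vanishing smooth section $\Omega$ over $M$ with $\bar\partial\Omega=0$. Suppose that at least one of $q$ and $r$, viewed as a $\Gamma$-periodic function on $\mathbb H_3^{\mathbb C}$, is not independent of the variable $z_3$. Then: 1. for every integer $l\ge 1$, the only $f\in C^\infty(M)$ (complex-valued) with $\bar\partial\bigl(f\,(\omega^{123})^{\otimes l}\bigr)=0$, where $\bar\partial$ is taken with respect to $J_{q,r}$, is $f=0$; 2. the canonical bundle of $J_{q,r}$ is not pseudoholomorphically trivial; 3. $\kappa_{J_{q,r}}=-\infty$. -/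

import Mathlib

open scoped TensorProduct ContDiff

noncomputable section

namespace Iwasawa

/-! ### The complex Heisenberg group, the lattice and the Iwasawa manifold -/

/-- The complex Heisenberg group in its global coordinates `(z₁, z₂, z₃)`, stored as
`(z 0, z 1, z 2)`. All tangent spaces are identified with the same real vector space. -/
abbrev H3 : Type := Fin 3 → ℂ

/-- The unipotent matrix with coordinates `z`. -/
def toMatrix (z : H3) : Matrix (Fin 3) (Fin 3) ℂ :=
  !![1, z 0, z 2; 0, 1, z 1; 0, 0, 1]

/-- The group law, i.e. left translation of `z` by `g`. -/
def heisMul (g z : H3) : H3 := ![g 0 + z 0, g 1 + z 1, g 2 + g 0 * z 1 + z 2]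

theorem toMatrix_heisMul (g z : H3) : toMatrix (heisMul g z) = toMatrix g * toMatrix z := by
  ext i j
  fin_cases i <;> fin_cases j <;>
    simp [toMatrix, heisMul, Matrix.mul_apply, Fin.sum_univ_succ] <;> ring

/-- The lattice of matrices with Gaussian integer entries. -/
def lattice : Set H3 := {g | ∀ i, g i ∈ GaussianInt.toComplex.range}

/-- The orbit relation of the lattice acting by left translations. -/
def orbitSetoid : Setoid H3 where
  r z w := ∃ g ∈ lattice, heisMul g z = w
  iseqv :=
    { refl := fun z => ⟨0, fun _ => Subring.zero_mem _, by
        ext i; fin_cases i <;> simp [heisMul]⟩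
      symm := by
        rintro z w ⟨g, hg, rfl⟩
        refine ⟨![-g 0, -g 1, -g 2 + g 0 * g 1], ?_, ?_⟩
        · intro i
          fin_cases i
          · exact Subring.neg_mem _ (hg 0)
          · exact Subring.neg_mem _ (hg 1)
          · exact Subring.add_mem _ (Subring.neg_mem _ (hg 2)) (Subring.mul_mem _ (hg 0) (hg 1))
        · ext i; fin_cases i <;> simp [heisMul]; ring
      trans := by
        rintro z w u ⟨g, hg, rfl⟩ ⟨k, hk, rfl⟩
        refine ⟨heisMul k g, ?_, ?_⟩
        · intro i
          fin_cases i
          · exact Subring.add_mem _ (hk 0) (hg 0)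
          · exact Subring.add_mem _ (hk 1) (hg 1)
          · exact Subring.add_mem _ (Subring.add_mem _ (hk 2) (Subring.mul_mem _ (hk 0) (hg 1)))
              (hg 2)
        · ext i; fin_cases i <;> simp [heisMul] <;> ring }

/-- The Iwasawa manifold, the quotient of the Heisenberg group by the lattice. -/
def Manifold : Type := Quotient orbitSetoid

/-- The universal covering map. -/
def proj (z : H3) : Manifold := Quotient.mk orbitSetoid z

theorem proj_heisMul {g : H3} (hg : g ∈ lattice) (z : H3) : proj (heisMul g z) = proj z :=
  (Quotient.sound (s := orbitSetoid) ⟨g, hg, rfl⟩ : Quotient.mk orbitSetoid z = _).symm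

/-- `C^∞(M)`: complex valued functions on the Iwasawa manifold which are smooth for the quotient
smooth structure, i.e. whose pullback to the covering is smooth. -/
structure SmoothFun where
  toFun : Manifold → ℂ
  smooth : ContDiff ℝ ∞ (fun z => toFun (proj z))

/-- The pullback of a smooth function to the covering. -/
def SmoothFun.lift (f : SmoothFun) (z : H3) : ℂ := f.toFun (proj z)

/-- The function does not depend on the variable `z₃`. -/
def SmoothFun.IndepOfZ3 (f : SmoothFun) : Prop :=
  ∀ z₁ z₂ z₃ w₃ : ℂ, f.lift ![z₁, z₂, z₃] = f.lift ![z₁, z₂, w₃]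

/-! ### Complex valued forms -/

/-- Complex valued real `k`-covectors. -/
abbrev Cov (k : ℕ) : Type := H3 [⋀^Fin k]→L[ℝ] ℂ

/-- The pullback of covectors along a real linear map, as a `ℂ`-linear map. -/
def pullCov {k : ℕ} (A : H3 →L[ℝ] H3) : Cov k →ₗ[ℂ] Cov k where
  toFun α := α.compContinuousLinearMap A
  map_add' _ _ := rfl
  map_smul' _ _ := rfl

/-- The differential at `x` of the left translation by `g`. -/
def dL (g x : H3) : H3 →L[ℝ] H3 := fderiv ℝ (heisMul g) x

/-- A form on the Heisenberg group that is invariant under the lattice, i.e. a form on the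
Iwasawa manifold. -/
def IsInvariantForm {k : ℕ} (α : H3 → Cov k) : Prop :=
  ∀ g ∈ lattice, ∀ x, pullCov (dL g x) (α (heisMul g x)) = α x

/-- The wedge product `θ ∧ α` of a `1`-covector and a `k`-covector:
`(θ ∧ α)(v₀, …, v_k) = ∑ᵢ (-1)ⁱ θ(vᵢ) α(v₀, …, omit vᵢ, …, v_k)`. -/
def wedge {k : ℕ} (θ : H3 →L[ℝ] ℂ) (α : Cov k) : Cov (k + 1) :=
  ContinuousAlternatingMap.alternatizeUncurryFin (θ.smulRight α)

/-! ### Almost complex structures and the bigrading -/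

/-- An almost complex structure on the Iwasawa manifold, given as a smooth lattice-invariant
almost complex structure on the Heisenberg group. -/
structure AlmostComplex where
  J : H3 → H3 →L[ℝ] H3
  smooth : ContDiff ℝ ∞ J
  sq : ∀ x v, J x (J x v) = -v
  invariant : ∀ g ∈ lattice, ∀ x v, J (heisMul g x) (dL g x v) = dL g x (J x v)

/-- A `k`-covector has type `(p, q)`, `p + q = k`, with respect to `J`: multiplication of all
vectors by the complex number `a + ib`, acting as `a + bJ`, multiplies it by
`(a + ib)^p (a - ib)^q`. -/
def IsType {k : ℕ} (J : H3 →L[ℝ] H3) (p q : ℕ) (α : Cov k) : Prop :=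
  ∀ (a b : ℝ) (v : Fin k → H3),
    α (fun i => a • v i + b • J (v i)) =
      ((a : ℂ) + b * Complex.I) ^ p * ((a : ℂ) - b * Complex.I) ^ q * α v

/-- The rotation `exp(tJ) = cos t + (sin t) J`. -/
def rot (J : H3 →L[ℝ] H3) (t : ℝ) : H3 →L[ℝ] H3 :=
  Real.cos t • ContinuousLinearMap.id ℝ H3 + Real.sin t • J

/-- The component of type `(p, k - p)` of a `k`-covector. Since `exp(tJ)` acts on covectors of
type `(p, q)` by the scalar `exp(i(p-q)t)`, this component is obtained by averaging
`exp(-i(2p-k)t) exp(tJ)^* α` over `t = πj/(k+1)`, `0 ≤ j ≤ k`. -/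
def typePart {k : ℕ} (J : H3 →L[ℝ] H3) (p : ℕ) (α : Cov k) : Cov k :=
  ((k : ℂ) + 1)⁻¹ • ∑ j ∈ Finset.range (k + 1),
    Complex.exp (-(Complex.I * (2 * p - k) * (Real.pi * j / (k + 1)))) •
      pullCov (rot J (Real.pi * j / (k + 1))) α

theorem IsType.pull_rot {k : ℕ} {J : H3 →L[ℝ] H3} {p q : ℕ} {α : Cov k} (h : IsType J p q α)
    (t : ℝ) :
    pullCov (rot J t) α = Complex.exp (Complex.I * ((p : ℂ) - q) * t) • α := by
  ext v
  have h1 := h (Real.cos t) (Real.sin t) v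
  have e1 : ((Real.cos t : ℝ) : ℂ) + (Real.sin t : ℝ) * Complex.I = Complex.exp (Complex.I * t) := by
    rw [mul_comm Complex.I, Complex.exp_mul_I]; simp
  have e2 : ((Real.cos t : ℝ) : ℂ) - (Real.sin t : ℝ) * Complex.I
      = Complex.exp (-(Complex.I * t)) := by
    rw [show -(Complex.I * (t : ℂ)) = (-(t : ℂ)) * Complex.I by ring, Complex.exp_mul_I]
    simp [sub_eq_add_neg]
  rw [e1, e2, ← Complex.exp_nat_mul, ← Complex.exp_nat_mul, ← Complex.exp_add] at h1
  have e3 : pullCov (rot J t) α v = α (fun i => Real.cos t • v i + Real.sin t • J (v i)) := rfl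
  rw [e3, h1]
  change _ = Complex.exp _ * α v
  congr 2
  ring

/-- `typePart J p` is the identity on covectors of type `(p, k - p)`. -/
theorem typePart_of_isType {k : ℕ} {J : H3 →L[ℝ] H3} {p q : ℕ} {α : Cov k} (hk : p + q = k)
    (h : IsType J p q α) : typePart J p α = α := by
  have key : ∀ j ∈ Finset.range (k + 1),
      Complex.exp (-(Complex.I * (2 * p - k) * (Real.pi * j / (k + 1)))) •
        pullCov (rot J (Real.pi * j / (k + 1))) α = α := by
    intro j _
    rw [h.pull_rot, smul_smul, ← Complex.exp_add]
    subst hk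
    push_cast
    rw [show -(Complex.I * (2 * (p : ℂ) - (p + q)) * (Real.pi * j / (p + q + 1))) +
      Complex.I * (p - q) * (Real.pi * j / (p + q + 1)) = 0 by ring, Complex.exp_zero, one_smul]
  have hk1 : ((k : ℂ) + 1) ≠ 0 := by exact_mod_cast Nat.succ_ne_zero k
  rw [typePart, Finset.sum_congr rfl key, Finset.sum_const, Finset.card_range,
    ← Nat.cast_smul_eq_nsmul ℂ, smul_smul]
  push_cast
  rw [inv_mul_cancel₀ hk1, one_smul]

/-- `typePart J p` vanishes on covectors of any other type `(p', k - p')`. -/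
theorem typePart_of_isType_of_ne {k : ℕ} {J : H3 →L[ℝ] H3} {p p' q' : ℕ} {α : Cov k}
    (hp : p ≤ k) (hk : p' + q' = k) (hne : p' ≠ p) (h : IsType J p' q' α) :
    typePart J p α = 0 := by
  have hk1 : ((k : ℂ) + 1) ≠ 0 := by exact_mod_cast Nat.succ_ne_zero k
  set ζ : ℂ := Complex.exp (2 * Real.pi * Complex.I * (((p' : ℤ) - p : ℤ) / (k + 1))) with hζ
  have key : ∀ j ∈ Finset.range (k + 1),
      Complex.exp (-(Complex.I * (2 * p - k) * (Real.pi * j / (k + 1)))) •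
        pullCov (rot J (Real.pi * j / (k + 1))) α = ζ ^ j • α := by
    intro j _
    rw [h.pull_rot, smul_smul, ← Complex.exp_add, hζ, ← Complex.exp_nat_mul]
    congr 2
    subst hk
    push_cast
    ring
  have hζk : ζ ^ (k + 1) = 1 := by
    rw [hζ, ← Complex.exp_nat_mul, Complex.exp_eq_one_iff]
    refine ⟨(p' : ℤ) - p, ?_⟩
    push_cast
    field_simp
  have hζ1 : ζ ≠ 1 := by
    intro h1
    rw [hζ, Complex.exp_eq_one_iff] at h1
    obtain ⟨n, hn⟩ := h1
    have h2 : (((p' : ℤ) - p : ℤ) : ℂ) / (k + 1) = n := by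
      have hpi : (2 * Real.pi * Complex.I : ℂ) ≠ 0 := Complex.two_pi_I_ne_zero
      apply mul_left_cancel₀ hpi
      rw [hn]; ring
    rw [div_eq_iff hk1] at h2
    have h3 : (p' : ℤ) - p = n * (k + 1) := by exact_mod_cast h2
    have h4 : n = 0 := by
      by_contra hn0
      rcases lt_or_gt_of_ne hn0 with hlt | hgt
      · have : n * ((k : ℤ) + 1) ≤ -1 * (k + 1) := by
          apply mul_le_mul_of_nonneg_right <;> omega
        omega
      · have : 1 * ((k : ℤ) + 1) ≤ n * (k + 1) := by
          apply mul_le_mul_of_nonneg_right <;> omega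
        omega
    subst h4
    apply hne
    omega
  rw [typePart, Finset.sum_congr rfl key, ← Finset.sum_smul]
  have hg : ∑ j ∈ Finset.range (k + 1), ζ ^ j = 0 := by
    have := geom_sum_mul ζ (k + 1)
    rw [hζk, sub_self] at this
    exact (mul_eq_zero.mp this).resolve_right (sub_ne_zero.mpr hζ1)
  rw [hg, zero_smul, smul_zero]

/-! ### The canonical bundle, `∂̄` and pluricanonical sections -/

/-- The covector lies in the fibre `Λ^{3,0}` of the canonical bundle: it is complex linear in
each argument with respect to `J`. -/
def IsCanonical (J : H3 →L[ℝ] H3) (α : Cov 3) : Prop :=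
  ∀ (v : Fin 3 → H3) (i : Fin 3), α (Function.update v i (J (v i))) = Complex.I * α v

/-- `∂̄` on functions: the `(0,1)`-part of `df`. -/
def dbarFun (𝒥 : AlmostComplex) (f : H3 → ℂ) (x : H3) : H3 →L[ℝ] ℂ :=
  (1 / 2 : ℂ) • (fderiv ℝ f x + Complex.I • (fderiv ℝ f x).comp (𝒥.J x))

/-- `∂̄` on `(3,0)`-forms: the `(3,1)`-part of the exterior derivative. -/
def dbarForm (𝒥 : AlmostComplex) (σ : H3 → Cov 3) (x : H3) : Cov 4 :=
  typePart (𝒥.J x) 3 (extDeriv σ x)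

/-- `∂̄_v σ`, the value of `∂̄σ` under the identification of `Λ^{3,1}` with `Λ^{0,1} ⊗ Λ^{3,0}`
(inverse to the wedge product): the contraction of the `(3,1)`-form `∂̄σ` with the
`(0,1)`-component `(v + iJv)/2` of the tangent vector `v`. -/
def dbarAlong (𝒥 : AlmostComplex) (σ : H3 → Cov 3) (x v : H3) : Cov 3 :=
  (1 / 2 : ℂ) • ((dbarForm 𝒥 σ x).curryLeft v
    + Complex.I • (dbarForm 𝒥 σ x).curryLeft (𝒥.J x v))

/-- The `l`-th tensor power of a `3`-covector. -/
def tpow (l : ℕ) (α : Cov 3) : ⨂[ℂ]^l (Cov 3) :=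
  PiTensorProduct.tprod ℂ (fun _ : Fin l => α)

/-- `∂̄_v (f σ^{⊗l})` for a function `f` and a `(3,0)`-form `σ`, by the Leibniz rule:
`(∂̄_v f) σ^{⊗l} + f ∑ⱼ σ ⊗ ⋯ ⊗ ∂̄_v σ ⊗ ⋯ ⊗ σ` with `∂̄_v σ` in the `j`-th place. -/
def dbarPow (𝒥 : AlmostComplex) (l : ℕ) (f : H3 → ℂ) (σ : H3 → Cov 3) (x v : H3) :
    ⨂[ℂ]^l (Cov 3) :=
  dbarFun 𝒥 f x v • tpow l (σ x) +
    f x • ∑ j : Fin l, PiTensorProduct.tprod ℂ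
      (Function.update (fun _ : Fin l => σ x) j (dbarAlong 𝒥 σ x v))

/-- A smooth local frame of the canonical bundle over `U`, i.e. a nowhere vanishing
`(3,0)`-form. -/
structure IsFrame (𝒥 : AlmostComplex) (U : Set H3) (σ : H3 → Cov 3) : Prop where
  smooth : ContDiffOn ℝ ∞ σ U
  canonical : ∀ x ∈ U, IsCanonical (𝒥.J x) (σ x)
  ne_zero : ∀ x ∈ U, σ x ≠ 0

theorem tpow_ne_zero (l : ℕ) {α : Cov 3} (h : α ≠ 0) : tpow l α ≠ 0 := by
  obtain ⟨v, hv⟩ : ∃ v, α v ≠ 0 := by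
    by_contra! hc
    exact h (ContinuousAlternatingMap.ext hc)
  let ev : Cov 3 →ₗ[ℂ] ℂ :=
    { toFun := fun β => β v, map_add' := fun _ _ => rfl, map_smul' := fun _ _ => rfl }
  intro h0
  have h1 := congrArg (PiTensorProduct.lift
    ((MultilinearMap.mkPiAlgebra ℂ (Fin l) ℂ).compLinearMap (fun _ => ev))) h0
  rw [tpow, PiTensorProduct.lift.tprod, map_zero] at h1
  simp only [MultilinearMap.compLinearMap_apply, MultilinearMap.mkPiAlgebra_apply,
    Finset.prod_const] at h1
  exact pow_ne_zero _ hv h1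

/-- The space `P_l` of smooth pseudoholomorphic sections of the `l`-th tensor power of the
canonical bundle of the Iwasawa manifold. Such a section is a lattice-invariant section `s` on the
Heisenberg group that in every smooth local frame `σ` of the canonical bundle has the form
`f σ^{⊗l}` with a smooth (and unique) coefficient `f`, and satisfies `∂̄(f σ^{⊗l}) = 0`. -/
def pluri (𝒥 : AlmostComplex) (l : ℕ) : Submodule ℂ (H3 → ⨂[ℂ]^l (Cov 3)) where
  carrier := {s |
    (∀ g ∈ lattice, ∀ x,
      PiTensorProduct.map (fun _ : Fin l => pullCov (k := 3) (dL g x)) (s (heisMul g x)) = s x) ∧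
    ∀ (U : Set H3) (σ : H3 → Cov 3), IsOpen U → IsFrame 𝒥 U σ →
      ∃ f : H3 → ℂ, ContDiffOn ℝ ∞ f U ∧ (∀ x ∈ U, s x = f x • tpow l (σ x)) ∧
        ∀ x ∈ U, ∀ v, dbarPow 𝒥 l f σ x v = 0}
  zero_mem' := by
    refine ⟨fun g _ x => by simp, fun U σ _ _ => ⟨0, contDiffOn_const, fun x _ => by simp, ?_⟩⟩
    intro x _ v
    have : dbarFun 𝒥 0 x v = 0 := by simp [dbarFun]
    simp [dbarPow, this]
  add_mem' := by
    rintro s t ⟨hs, hs2⟩ ⟨ht, ht2⟩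
    refine ⟨fun g hg x => by simp [hs g hg x, ht g hg x], fun U σ hU hσ => ?_⟩
    obtain ⟨f, hf, hfs, hfd⟩ := hs2 U σ hU hσ
    obtain ⟨h, hh, hht, hhd⟩ := ht2 U σ hU hσ
    refine ⟨f + h, hf.add hh, fun x hx => by simp [hfs x hx, hht x hx, add_smul], ?_⟩
    intro x hx v
    have d1 : DifferentiableAt ℝ f x :=
      (hf.contDiffAt (hU.mem_nhds hx)).differentiableAt (by simp)
    have d2 : DifferentiableAt ℝ h x :=
      (hh.contDiffAt (hU.mem_nhds hx)).differentiableAt (by simp)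
    have e : dbarFun 𝒥 (f + h) x v = dbarFun 𝒥 f x v + dbarFun 𝒥 h x v := by
      simp [dbarFun, fderiv_add d1 d2]; ring
    have e1 := hfd x hx v
    have e2 := hhd x hx v
    rw [dbarPow] at e1 e2 ⊢
    rw [e, Pi.add_apply, add_smul, add_smul, add_add_add_comm, e1, e2, add_zero]
  smul_mem' := by
    rintro c s ⟨hs, hs2⟩
    refine ⟨fun g hg x => by simp [hs g hg x], fun U σ hU hσ => ?_⟩
    obtain ⟨f, hf, hfs, hfd⟩ := hs2 U σ hU hσ
    refine ⟨c • f, hf.const_smul c, fun x hx => by simp [hfs x hx, smul_smul], ?_⟩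
    intro x hx v
    have d1 : DifferentiableAt ℝ f x :=
      (hf.contDiffAt (hU.mem_nhds hx)).differentiableAt (by simp)
    have e : dbarFun 𝒥 (c • f) x v = c * dbarFun 𝒥 f x v := by
      simp [dbarFun, fderiv_const_smul d1 c]; ring
    have e1 := hfd x hx v
    rw [dbarPow] at e1 ⊢
    rw [e, Pi.smul_apply, smul_eq_mul, mul_smul, mul_smul, ← smul_add, e1, smul_zero]

/-- The canonical bundle is pseudoholomorphically trivial: there is a nowhere vanishing smooth
`(3,0)`-form on the Iwasawa manifold which is `∂̄`-closed. -/
def PseudoholomorphicallyTrivial (𝒥 : AlmostComplex) : Prop :=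
  ∃ Ω : H3 → Cov 3, IsInvariantForm Ω ∧ IsFrame 𝒥 Set.univ Ω ∧ ∀ x, dbarForm 𝒥 Ω x = 0

/-- `dim_ℂ P_l`, as an extended natural number seen in `[0, ∞]`. -/
def pluriDim (𝒥 : AlmostComplex) (l : ℕ) : ENNReal :=
  ((Cardinal.toENat (Module.rank ℂ (pluri 𝒥 l)) : ℕ∞) : ENNReal)

open Classical in
/-- The Kodaira dimension of an almost complex structure on the Iwasawa manifold (with the
convention `log 0 = -∞` in the limit superior). -/
def kodairaDim (𝒥 : AlmostComplex) : EReal :=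
  if ∀ l : ℕ, 1 ≤ l → pluri 𝒥 l = ⊥ then ⊥
  else Filter.limsup (fun l : ℕ => ENNReal.log (pluriDim 𝒥 l) / ((Real.log l : ℝ) : EReal))
    Filter.atTop

/-! ### The structures `J_{q,r}` -/

/-- The left-invariant coframe `φ¹ = dz₁`, `φ² = dz₂`, `φ³ = dz₃ - z₁ dz₂`. -/
def phi (x : H3) : Fin 3 → (H3 →L[ℝ] ℂ) :=
  ![ContinuousLinearMap.proj 0, ContinuousLinearMap.proj 1,
    ContinuousLinearMap.proj 2 - x 0 • ContinuousLinearMap.proj 1]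

/-- The conjugate coframe. -/
def phiBar (x : H3) (j : Fin 3) : H3 →L[ℝ] ℂ :=
  (Complex.conjCLE : ℂ →L[ℝ] ℂ).comp (phi x j)

/-- The coframe `ω¹ = φ¹`, `ω² = φ²`, `ω³ = φ³ + q φ^{1̄} + r φ^{2̄}`. -/
def omega (q r : SmoothFun) (x : H3) : Fin 3 → (H3 →L[ℝ] ℂ) :=
  ![phi x 0, phi x 1, phi x 2 + q.lift x • phiBar x 0 + r.lift x • phiBar x 1]

/-- The form `ω^{123} = ω¹ ∧ ω² ∧ ω³`. -/
def omega123 (q r : SmoothFun) (x : H3) : Cov 3 :=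
  wedge (omega q r x 0) (wedge (omega q r x 1) (wedge (omega q r x 2)
    (ContinuousAlternatingMap.constOfIsEmpty ℝ H3 (Fin 0) (1 : ℂ))))

/-- The endomorphism `v ↦ (i v₁, i v₂, i v₃ + 2i (q v̄₁ + r v̄₂))`. -/
def Jmap (a b : ℂ) : H3 →L[ℝ] H3 :=
  ContinuousLinearMap.pi
    ![Complex.I • ContinuousLinearMap.proj 0,
      Complex.I • ContinuousLinearMap.proj 1,
      Complex.I • ContinuousLinearMap.proj 2 +
        (2 * Complex.I * a) • (Complex.conjCLE : ℂ →L[ℝ] ℂ).comp (ContinuousLinearMap.proj 0) +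
        (2 * Complex.I * b) • (Complex.conjCLE : ℂ →L[ℝ] ℂ).comp (ContinuousLinearMap.proj 1)]

theorem Jmap_apply (a b : ℂ) (v : H3) :
    Jmap a b v = ![Complex.I * v 0, Complex.I * v 1,
      Complex.I * v 2 + 2 * Complex.I * a * (starRingEnd ℂ) (v 0) +
        2 * Complex.I * b * (starRingEnd ℂ) (v 1)] := by
  ext i; fin_cases i <;> simp [Jmap]

theorem dL_apply (g x v : H3) : dL g x v = ![v 0, v 1, v 2 + g 0 * v 1] := by
  have h : HasFDerivAt (heisMul g)
      (ContinuousLinearMap.pi ![ContinuousLinearMap.proj 0, ContinuousLinearMap.proj 1,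
        ContinuousLinearMap.proj 2 + g 0 • ContinuousLinearMap.proj 1] : H3 →L[ℝ] H3) x := by
    rw [hasFDerivAt_pi']
    have p (j : Fin 3) : HasFDerivAt (fun z : H3 => z j)
        (ContinuousLinearMap.proj j : H3 →L[ℝ] ℂ) x := hasFDerivAt_apply j x
    intro i
    fin_cases i
    · exact (p 0).const_add (g 0)
    · exact (p 1).const_add (g 1)
    · exact (((p 1).const_mul (g 0)).const_add (g 2)).add (p 2) |>.congr_fderiv (by
        ext w
        simp [add_comm])
  rw [dL, h.fderiv]
  ext i; fin_cases i <;> simp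

theorem lift_heisMul (f : SmoothFun) {g : H3} (hg : g ∈ lattice) (x : H3) :
    f.lift (heisMul g x) = f.lift x := by
  rw [SmoothFun.lift, SmoothFun.lift, proj_heisMul hg]

/-- The almost complex structure `J_{q,r}` on the Iwasawa manifold whose `(1,0)`-forms are
spanned by the coframe `ω¹, ω², ω³` (see `omega_Jqr` and `eq_Jqr_of_omega`). -/
def Jqr (q r : SmoothFun) : AlmostComplex where
  J x := Jmap (q.lift x) (r.lift x)
  smooth := by
    have hq : ContDiff ℝ ∞ q.lift := q.smooth
    have hr : ContDiff ℝ ∞ r.lift := r.smooth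
    rw [contDiff_clm_apply_iff]
    intro v
    simp only [Jmap_apply]
    rw [contDiff_pi]
    intro i
    fin_cases i
    · exact contDiff_const
    · exact contDiff_const
    · exact (contDiff_const.add ((contDiff_const.mul hq).mul contDiff_const)).add
        ((contDiff_const.mul hr).mul contDiff_const)
  sq x v := by
    ext i
    fin_cases i <;> simp [Jmap_apply, mul_add, ← mul_assoc]; ring_nf
  invariant g hg x v := by
    rw [lift_heisMul q hg, lift_heisMul r hg]
    ext i
    fin_cases i <;> simp [Jmap_apply, dL_apply]; ring

/-- The forms `ωʲ` are of type `(1,0)` for `J_{q,r}`. -/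
theorem omega_Jqr (q r : SmoothFun) (x v : H3) (j : Fin 3) :
    omega q r x j ((Jqr q r).J x v) = Complex.I * omega q r x j v := by
  fin_cases j <;> simp [omega, phi, phiBar, Jqr, Jmap_apply]; ring

/-- `J_{q,r}` is the only endomorphism for which the forms `ωʲ` are of type `(1,0)`. -/
theorem eq_Jqr_of_omega (q r : SmoothFun) (x : H3) (A : H3 →L[ℝ] H3)
    (h : ∀ v j, omega q r x j (A v) = Complex.I * omega q r x j v) : A = (Jqr q r).J x := by
  refine ContinuousLinearMap.ext fun v => ?_
  have h1 (j : Fin 3) : omega q r x j (A v) = omega q r x j ((Jqr q r).J x v) := by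
    rw [h, omega_Jqr]
  have e0 : A v 0 = (Jqr q r).J x v 0 := h1 0
  have e1 : A v 1 = (Jqr q r).J x v 1 := h1 1
  have e2 := h1 2
  simp [omega, phi, phiBar, e0, e1] at e2
  ext i
  fin_cases i
  · exact e0
  · exact e1
  · exact e2

end Iwasawa

end

noncomputable section

namespace Iwasawa

/-! ### The wedge product -/

/-! The form `ω^{123} = dz₁ ∧ dz₂ ∧ (dz₃ + q dz̄₁ + r dz̄₂)` is a global lattice-invariant frame of
the canonical bundle, so everything reduces to one scalar equation. The `(3,1)`-part of its
differential is `Γ ∧ ω^{123}` with `Γ = -(∂q/∂z₃) dz̄₁ - (∂r/∂z₃) dz̄₂` (`dbarForm_omega123`). Hence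
`f (ω^{123})^{⊗l}` is `∂̄`-closed exactly when `∂̄f + l f Γ = 0` (`dbarPow_omega123_eq_zero_iff`).

In the `z₃` direction `J` is multiplication by `i` and `Γ` vanishes. So `f` is holomorphic along the
fibres `ℂ/ℤ[i]`, and is constant on each of them by Liouville. The other two directions then give
`∂f/∂z̄₁ = l f ∂q/∂z₃` and `∂f/∂z̄₂ = l f ∂r/∂z₃`. Where `f ≠ 0`, this makes `∂q/∂z₃` and `∂r/∂z₃`
constant along the fibre. A doubly periodic function with constant `∂/∂z` is constant
(`periodic_eq_of_conj_deriv_const`), so both derivatives are zero there.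

The right-hand sides therefore vanish everywhere, and Liouville in `z₁` and `z₂` shows that `f` is
constant. A nonzero constant would force both `q` and `r` to be independent of `z₃`, against the
hypothesis (`eq_zero_of_dbar_eq_zero`). All three claims follow by writing sections in the frame
`ω^{123}`. -/

theorem wedge_apply {k : ℕ} (θ : H3 →L[ℝ] ℂ) (α : Cov k) (v : Fin (k + 1) → H3) :
    wedge θ α v = ∑ i : Fin (k + 1), (-1) ^ (i : ℕ) * (θ (v i) * α (i.removeNth v)) := by
  simp [wedge, ContinuousAlternatingMap.alternatizeUncurryFin_apply]

theorem wedge_add_left {k : ℕ} (θ η : H3 →L[ℝ] ℂ) (α : Cov k) :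
    wedge (θ + η) α = wedge θ α + wedge η α := by
  ext v
  simp [wedge_apply, add_mul, mul_add, Finset.sum_add_distrib]

theorem wedge_smul_left {k : ℕ} (c : ℂ) (θ : H3 →L[ℝ] ℂ) (α : Cov k) :
    wedge (c • θ) α = c • wedge θ α := by
  ext v
  simp only [wedge_apply, smul_apply, ContinuousAlternatingMap.smul_apply,
    smul_eq_mul, Finset.mul_sum]
  exact Finset.sum_congr rfl fun i _ => by ring

theorem wedge_zero_right {k : ℕ} (θ : H3 →L[ℝ] ℂ) : wedge θ (0 : Cov k) = 0 := by
  ext v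
  simp [wedge_apply]

/-- The left side is the double alternatization of the bilinear map `(x, y) ↦ (θ x η y + η x θ y)
α`. This map is symmetric, so the double alternatization vanishes, by the mechanism behind `d² = 0`.
-/
theorem wedge_wedge_add_swap {k : ℕ} (θ η : H3 →L[ℝ] ℂ) (α : Cov k) :
    wedge θ (wedge η α) + wedge η (wedge θ α) = 0 := by
  let f : H3 →L[ℝ] H3 →L[ℝ] Cov k := LinearMap.toContinuousLinearMap
    { toFun := fun x => (θ x • η + η x • θ).smulRight α
      map_add' := fun x y => by
        ext z v
        simp
        ring
      map_smul' := fun c x => by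
        ext z v
        simp
        ring }
  have hf (x : H3) : f x = (θ x • η + η x • θ).smulRight α := rfl
  have h := ContinuousAlternatingMap.alternatizeUncurryFin_alternatizeUncurryFinCLM_comp_of_symmetric
    (f := f) (fun x y => by
      ext v
      change (θ x * η y + η x * θ y) * α v = (θ y * η x + η y * θ x) * α v
      ring)
  rw [← h]
  ext v
  have hw (x : H3) (u : Fin (k + 1) → H3) :
      wedge (θ x • η + η x • θ) α u = θ x * wedge η α u + η x * wedge θ α u := by
    rw [wedge_add_left, wedge_smul_left, wedge_smul_left]
    rfl
  rw [ContinuousAlternatingMap.alternatizeUncurryFin_apply, ContinuousAlternatingMap.add_apply,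
    wedge_apply, wedge_apply, ← Finset.sum_add_distrib]
  refine Finset.sum_congr rfl fun i _ => ?_
  change _ = (-1 : ℤ) ^ (i : ℕ) • wedge (θ (v i) • η + η (v i) • θ) α (i.removeNth v)
  rw [hw]
  simp

theorem wedge_neg_right {k : ℕ} (θ : H3 →L[ℝ] ℂ) (α : Cov k) : wedge θ (-α) = -wedge θ α := by
  ext v
  simp [wedge_apply]

theorem wedge_swap {k : ℕ} (θ η : H3 →L[ℝ] ℂ) (α : Cov k) :
    wedge θ (wedge η α) = -wedge η (wedge θ α) :=
  eq_neg_of_add_eq_zero_left (wedge_wedge_add_swap θ η α)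

theorem wedge_wedge_self {k : ℕ} (θ : H3 →L[ℝ] ℂ) (α : Cov k) : wedge θ (wedge θ α) = 0 := by
  have h := wedge_wedge_add_swap θ θ α
  rw [← two_smul ℂ] at h
  exact (smul_eq_zero.mp h).resolve_left two_ne_zero

/-- The constant `0`-covector `1`. -/
abbrev oneCov : Cov 0 :=
  ContinuousAlternatingMap.constOfIsEmpty ℝ H3 (Fin 0) (1 : ℂ)

theorem wedge_wedge_wedge_one_apply (θ₁ θ₂ θ₃ : H3 →L[ℝ] ℂ) (v : Fin 3 → H3) :
    wedge θ₁ (wedge θ₂ (wedge θ₃ oneCov)) v =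
      θ₁ (v 0) * (θ₂ (v 1) * θ₃ (v 2) - θ₂ (v 2) * θ₃ (v 1))
      - θ₁ (v 1) * (θ₂ (v 0) * θ₃ (v 2) - θ₂ (v 2) * θ₃ (v 0))
      + θ₁ (v 2) * (θ₂ (v 0) * θ₃ (v 1) - θ₂ (v 1) * θ₃ (v 0)) := by
  simp [wedge_apply, Fin.sum_univ_succ, Fin.removeNth, Fin.succAbove]
  ring

/-! ### Types of covectors -/

theorem isType_oneCov (J : H3 →L[ℝ] H3) : IsType J 0 0 oneCov := by
  intro a b v
  simp

theorem IsType.wedge_of_linear {k p q : ℕ} {J : H3 →L[ℝ] H3} {α : Cov k} (h : IsType J p q α)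
    {θ : H3 →L[ℝ] ℂ} (hθ : ∀ v, θ (J v) = Complex.I * θ v) :
    IsType J (p + 1) q (wedge θ α) := by
  intro a b v
  rw [wedge_apply, wedge_apply, Finset.mul_sum]
  refine Finset.sum_congr rfl fun i _ => ?_
  have h1 := h a b (i.removeNth v)
  change α (i.removeNth fun i => a • v i + b • J (v i)) = _ at h1
  rw [h1]
  simp only [map_add, map_smul, hθ, Complex.real_smul]
  ring

theorem IsType.wedge_of_antilinear {k p q : ℕ} {J : H3 →L[ℝ] H3} {α : Cov k} (h : IsType J p q α)
    {θ : H3 →L[ℝ] ℂ} (hθ : ∀ v, θ (J v) = -(Complex.I * θ v)) :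
    IsType J p (q + 1) (wedge θ α) := by
  intro a b v
  rw [wedge_apply, wedge_apply, Finset.mul_sum]
  refine Finset.sum_congr rfl fun i _ => ?_
  have h1 := h a b (i.removeNth v)
  change α (i.removeNth fun i => a • v i + b • J (v i)) = _ at h1
  rw [h1]
  simp only [map_add, map_smul, hθ, Complex.real_smul]
  ring

theorem typePart_add {k : ℕ} (J : H3 →L[ℝ] H3) (p : ℕ) (α β : Cov k) :
    typePart J p (α + β) = typePart J p α + typePart J p β := by
  simp only [typePart, map_add, smul_add, Finset.sum_add_distrib]

theorem typePart_smul {k : ℕ} (J : H3 →L[ℝ] H3) (p : ℕ) (c : ℂ) (α : Cov k) :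
    typePart J p (c • α) = c • typePart J p α := by
  simp only [typePart, map_smul, Finset.smul_sum]
  refine Finset.sum_congr rfl fun i _ => ?_
  rw [smul_comm c, smul_comm c]

/-- The `(1,0)`-part of a `1`-covector. -/
def part10 (J : H3 →L[ℝ] H3) (θ : H3 →L[ℝ] ℂ) : H3 →L[ℝ] ℂ :=
  (1 / 2 : ℂ) • (θ - Complex.I • θ.comp J)

/-- The `(0,1)`-part of a `1`-covector. -/
def part01 (J : H3 →L[ℝ] H3) (θ : H3 →L[ℝ] ℂ) : H3 →L[ℝ] ℂ :=
  (1 / 2 : ℂ) • (θ + Complex.I • θ.comp J)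

theorem part10_apply (J : H3 →L[ℝ] H3) (θ : H3 →L[ℝ] ℂ) (v : H3) :
    part10 J θ v = 1 / 2 * (θ v - Complex.I * θ (J v)) := rfl

theorem part01_apply (J : H3 →L[ℝ] H3) (θ : H3 →L[ℝ] ℂ) (v : H3) :
    part01 J θ v = 1 / 2 * (θ v + Complex.I * θ (J v)) := rfl

theorem part10_add_part01 (J : H3 →L[ℝ] H3) (θ : H3 →L[ℝ] ℂ) :
    part10 J θ + part01 J θ = θ := by
  ext v
  rw [add_apply, part10_apply, part01_apply]
  ring

theorem part10_comp (J : H3 →L[ℝ] H3) (hJ : ∀ v, J (J v) = -v) (θ : H3 →L[ℝ] ℂ) (v : H3) :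
    part10 J θ (J v) = Complex.I * part10 J θ v := by
  rw [part10_apply, part10_apply, hJ, map_neg]
  linear_combination (1 / 2 * θ (J v)) * Complex.I_sq

theorem part01_comp (J : H3 →L[ℝ] H3) (hJ : ∀ v, J (J v) = -v) (θ : H3 →L[ℝ] ℂ) (v : H3) :
    part01 J θ (J v) = -(Complex.I * part01 J θ v) := by
  rw [part01_apply, part01_apply, hJ, map_neg]
  linear_combination (1 / 2 * θ (J v)) * Complex.I_sq

/-- The `(1,0)`-part of `θ` raises the type to `(p+1, q)`, which the projection kills; only the
`(0,1)`-part survives. The companion lemma below selects the other half. -/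
theorem IsType.typePart_wedge_add {p q : ℕ} {J : H3 →L[ℝ] H3} {α : Cov (p + q)}
    (hJ : ∀ v, J (J v) = -v) (h : IsType J p q α) (θ : H3 →L[ℝ] ℂ) :
    typePart J p (wedge θ α) = wedge (part01 J θ) α := by
  conv_lhs => rw [← part10_add_part01 J θ, wedge_add_left, typePart_add]
  rw [typePart_of_isType_of_ne (p' := p + 1) (q' := q) (by omega) (by omega) (by omega)
      (h.wedge_of_linear (part10_comp J hJ θ)),
    typePart_of_isType (q := q + 1) (by omega) (h.wedge_of_antilinear (part01_comp J hJ θ)),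
    zero_add]

theorem IsType.typePart_succ_wedge_add {p q : ℕ} {J : H3 →L[ℝ] H3} {α : Cov (p + q)}
    (hJ : ∀ v, J (J v) = -v) (h : IsType J p q α) (θ : H3 →L[ℝ] ℂ) :
    typePart J (p + 1) (wedge θ α) = wedge (part10 J θ) α := by
  conv_lhs => rw [← part10_add_part01 J θ, wedge_add_left, typePart_add]
  rw [typePart_of_isType_of_ne (p' := p) (q' := q + 1) (by omega) (by omega) (by omega)
      (h.wedge_of_antilinear (part01_comp J hJ θ)),
    typePart_of_isType (q := q) (by omega) (h.wedge_of_linear (part10_comp J hJ θ)),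
    add_zero]

/-- Contraction of `Λ ∧ α` with the `(0,1)`-component of a vector, for `Λ` of type `(0,1)` and
`α` in the canonical bundle. -/
theorem IsCanonical.contract_wedge {J : H3 →L[ℝ] H3} {α : Cov 3} (hα : IsCanonical J α)
    {Λ : H3 →L[ℝ] ℂ} (hΛ : ∀ v, Λ (J v) = -(Complex.I * Λ v)) (v : H3) :
    (1 / 2 : ℂ) • ((wedge Λ α).curryLeft v + Complex.I • (wedge Λ α).curryLeft (J v)) =
      Λ v • α := by
  ext w
  have hc (u : Fin 2 → H3) : α (Fin.cons (J v) u : Fin 3 → H3) =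
      Complex.I * α (Fin.cons v u : Fin 3 → H3) := by
    have := hα (Fin.cons v u) 0
    rwa [Fin.cons_zero, Fin.update_cons_zero] at this
  have hr (y : H3) (i : Fin 3) : (Fin.removeNth i.succ (Matrix.vecCons y w) : Fin 3 → H3) =
      (Fin.cons y (i.removeNth w) : Fin 3 → H3) := by
    ext j : 1
    refine Fin.cases ?_ (fun j => ?_) j <;> simp [Fin.removeNth]
  have h0 (y : H3) : (Fin.removeNth 0 (Matrix.vecCons y w) : Fin 3 → H3) = w := by
    ext j : 1
    simp [Fin.removeNth]
  have key (y : H3) : (wedge Λ α).curryLeft y w = Λ y * α w +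
      ∑ i : Fin 3, (-1) ^ ((i : ℕ) + 1) * (Λ (w i) * α (Fin.cons y (i.removeNth w))) := by
    rw [ContinuousAlternatingMap.curryLeft_apply_apply, wedge_apply, Fin.sum_univ_succ, h0]
    simp only [hr]
    simp
  simp only [ContinuousAlternatingMap.smul_apply, ContinuousAlternatingMap.add_apply, key, hc, hΛ,
    smul_eq_mul, Fin.sum_univ_three]
  linear_combination (-(1 / 2) * Λ v * α w - 1 / 2 *
    ((-1) ^ ((0 : Fin 3) : ℕ) * (Λ (w 0) * α (Fin.cons v (Fin.removeNth 0 w)))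
    + (-1) ^ ((1 : Fin 3) : ℕ) * (Λ (w 1) * α (Fin.cons v (Fin.removeNth 1 w)))
    + (-1) ^ ((2 : Fin 3) : ℕ) * (Λ (w 2) * α (Fin.cons v (Fin.removeNth 2 w))))) * Complex.I_sq

/-! ### Periodic functions of one complex variable -/

/-- An entire function with periods `1` and `I` is constant. -/
theorem entire_periodic_eq {h : ℂ → ℂ} (hd : Differentiable ℂ h) (h1 : ∀ z, h (z + 1) = h z)
    (hI : ∀ z, h (z + Complex.I) = h z) (z w : ℂ) : h z = h w := by
  refine hd.apply_eq_apply_of_bounded ?_ z w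
  have p1 : Function.Periodic h 1 := h1
  have pI : Function.Periodic h Complex.I := hI
  -- By periodicity the range of `h` is contained in the image of the closed unit square, which is
  -- compact; Liouville applies.
  refine (((isCompact_Icc (a := (0 : ℝ)) (b := 1)).prod
    (isCompact_Icc (a := (0 : ℝ)) (b := 1))).image_of_continuousOn
    (f := fun p : ℝ × ℝ => h ((p.1 : ℂ) + p.2 * Complex.I)) ?_).isBounded.subset ?_
  · have := hd.continuous
    fun_prop
  · rintro _ ⟨u, rfl⟩
    refine ⟨(Int.fract u.re, Int.fract u.im), ⟨⟨Int.fract_nonneg _, (Int.fract_lt_one _).le⟩,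
      ⟨Int.fract_nonneg _, (Int.fract_lt_one _).le⟩⟩, ?_⟩
    have e : ((Int.fract u.re : ℝ) : ℂ) + (Int.fract u.im : ℝ) * Complex.I =
        u - ⌊u.re⌋ * 1 - ⌊u.im⌋ * Complex.I := by
      apply Complex.ext <;> simp [Int.self_sub_floor]
    change h (((Int.fract u.re : ℝ) : ℂ) + (Int.fract u.im : ℝ) * Complex.I) = h u
    rw [e, pI.sub_int_mul_eq, p1.sub_int_mul_eq]

/-- A real differentiable function with periods `1` and `I` that satisfies the Cauchy-Riemann
equation is constant. -/
theorem periodic_eq_of_cauchyRiemann {g : ℂ → ℂ} (hd : Differentiable ℝ g)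
    (h1 : ∀ z, g (z + 1) = g z) (hI : ∀ z, g (z + Complex.I) = g z)
    (hcr : ∀ z, fderiv ℝ g z 1 + Complex.I * fderiv ℝ g z Complex.I = 0) (z w : ℂ) :
    g z = g w := by
  refine entire_periodic_eq (fun z => ?_) h1 hI z w
  refine differentiableAt_complex_iff_differentiableAt_real.mpr ⟨hd z, ?_⟩
  rw [smul_eq_mul]
  linear_combination -Complex.I * hcr z + fderiv ℝ g z Complex.I * Complex.I_sq

/-- A real differentiable function with periods `1` and `I` whose derivative `∂/∂z` is constant
is constant. -/
theorem periodic_eq_of_conj_deriv_const {g : ℂ → ℂ} (hd : Differentiable ℝ g)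
    (h1 : ∀ z, g (z + 1) = g z) (hI : ∀ z, g (z + Complex.I) = g z) {c : ℂ}
    (hc : ∀ z, fderiv ℝ g z 1 - Complex.I * fderiv ℝ g z Complex.I = 2 * c) (z w : ℂ) :
    g z = g w := by
  -- Since `∂(g - cz)/∂z = 0`, the conjugate of `g - cz` is entire. It is periodic only up to
  -- additive constants, but its derivative is truly periodic and hence constant.
  set h : ℂ → ℂ := fun z => (starRingEnd ℂ) (g z) - (starRingEnd ℂ) (c * z) with hh
  have hder (z : ℂ) : HasFDerivAt h ((Complex.conjCLE : ℂ →L[ℝ] ℂ).comp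
      (fderiv ℝ g z - c • ContinuousLinearMap.id ℝ ℂ)) z := by
    have e1 : HasFDerivAt (fun z => g z - c * z)
        (fderiv ℝ g z - c • ContinuousLinearMap.id ℝ ℂ) z :=
      (hd z).hasFDerivAt.sub ((hasFDerivAt_id z).const_mul c)
    have e2 := (Complex.conjCLE : ℂ →L[ℝ] ℂ).hasFDerivAt.comp z e1
    refine e2.congr_of_eventuallyEq (Filter.Eventually.of_forall fun y => ?_)
    simp [hh]
  have hent : Differentiable ℂ h := fun z => by
    refine differentiableAt_complex_iff_differentiableAt_real.mpr ⟨(hder z).differentiableAt, ?_⟩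
    rw [(hder z).fderiv]
    have e := congrArg (starRingEnd ℂ) (hc z)
    simp only [map_sub, map_mul, Complex.conj_I, map_ofNat] at e
    simp
    linear_combination -Complex.I * e +
      (starRingEnd ℂ) (fderiv ℝ g z Complex.I) * Complex.I_sq
  have hs1 (z : ℂ) : h (z + 1) = h z - (starRingEnd ℂ) c := by
    simp [hh, h1, mul_add]
    ring
  have hsI (z : ℂ) : h (z + Complex.I) = h z + Complex.I * (starRingEnd ℂ) c := by
    simp [hh, hI, mul_add]
    ring
  have hd1 (z : ℂ) : deriv h (z + 1) = deriv h z := by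
    rw [← deriv_comp_add_const]
    simp only [hs1, deriv_sub_const_fun]
  have hdI (z : ℂ) : deriv h (z + Complex.I) = deriv h z := by
    rw [← deriv_comp_add_const]
    simp only [hsI, deriv_add_const]
  have hconst := entire_periodic_eq (hent.deriv) hd1 hdI
  have hlin (z : ℂ) : h z = h 0 + deriv h 0 * z := by
    have hd' : Differentiable ℂ (fun z => h z - deriv h 0 * z) := by fun_prop
    have := is_const_of_deriv_eq_zero hd' (fun z => by
      rw [deriv_fun_sub hent.differentiableAt (by fun_prop), deriv_const_mul_field,
        deriv_id'', hconst z 0]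
      ring) z 0
    linear_combination this
  have a1 := hs1 0
  have a2 := hsI 0
  rw [hlin (0 + 1)] at a1
  rw [hlin (0 + Complex.I)] at a2
  -- The slope of the affine function `h` is `-c̄` by the period `1` and `c̄` by the period `I`, so
  -- both are zero.
  have hc0 : (starRingEnd ℂ) c = 0 := by
    have : (2 * Complex.I) * (starRingEnd ℂ) c = 0 := by linear_combination Complex.I * a1 - a2
    exact (mul_eq_zero.mp this).resolve_left (by simp)
  have hα : deriv h 0 = 0 := by linear_combination a1 - hc0
  have hc' : c = 0 := by simpa using hc0
  have e := (hlin z).trans ((by rw [hα]; ring : _ = h 0 + deriv h 0 * w).trans (hlin w).symm)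
  simp only [hh, hc', zero_mul, map_zero, sub_zero] at e
  exact (starRingEnd ℂ).injective e

/-! ### The form `ω^{123}` -/

/-- The real coordinate vectors, viewed as tangent vectors. -/
def coordFrame : Fin 3 → H3 := fun i => Pi.single i 1

theorem omega123_apply (q r : SmoothFun) (x : H3) (v : Fin 3 → H3) :
    omega123 q r x v =
      omega q r x 0 (v 0) * (omega q r x 1 (v 1) * omega q r x 2 (v 2)
        - omega q r x 1 (v 2) * omega q r x 2 (v 1))
      - omega q r x 0 (v 1) * (omega q r x 1 (v 0) * omega q r x 2 (v 2)
        - omega q r x 1 (v 2) * omega q r x 2 (v 0))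
      + omega q r x 0 (v 2) * (omega q r x 1 (v 0) * omega q r x 2 (v 1)
        - omega q r x 1 (v 1) * omega q r x 2 (v 0)) :=
  wedge_wedge_wedge_one_apply _ _ _ v

theorem omega_zero_apply (q r : SmoothFun) (x v : H3) : omega q r x 0 v = v 0 := rfl

theorem omega_one_apply (q r : SmoothFun) (x v : H3) : omega q r x 1 v = v 1 := rfl

theorem omega_two_apply (q r : SmoothFun) (x v : H3) : omega q r x 2 v =
    v 2 - x 0 * v 1 + q.lift x * (starRingEnd ℂ) (v 0) + r.lift x * (starRingEnd ℂ) (v 1) := rfl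

/-- This normalization shows that the form vanishes nowhere, and lets the coefficient of any
canonical covector be read off on `coordFrame`. -/
theorem omega123_coordFrame (q r : SmoothFun) (x : H3) : omega123 q r x coordFrame = 1 := by
  simp [omega123_apply, omega_zero_apply, omega_one_apply, omega_two_apply, coordFrame]

theorem omega123_ne_zero (q r : SmoothFun) (x : H3) : omega123 q r x ≠ 0 := by
  intro h
  have := omega123_coordFrame q r x
  rw [h] at this
  exact zero_ne_one this

theorem isCanonical_omega123 (q r : SmoothFun) (x : H3) :
    IsCanonical ((Jqr q r).J x) (omega123 q r x) := by
  intro v i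
  rw [omega123_apply, omega123_apply]
  fin_cases i <;> simp [omega_Jqr] <;> ring

theorem isType_omega123 (q r : SmoothFun) (x : H3) :
    IsType ((Jqr q r).J x) 3 0 (omega123 q r x) :=
  (((isType_oneCov _).wedge_of_linear fun v => omega_Jqr q r x v 2).wedge_of_linear
    fun v => omega_Jqr q r x v 1).wedge_of_linear fun v => omega_Jqr q r x v 0

/-- In `dz₃ - z₁ dz₂` the shift of `z₁` by `g 0` cancels the term `g 0 * v 1` coming from `dL`; the
remaining ingredients are plainly invariant. -/
theorem isInvariantForm_omega123 (q r : SmoothFun) : IsInvariantForm (omega123 q r) := by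
  intro g hg x
  ext v
  change omega123 q r (heisMul g x) (fun i => dL g x (v i)) = omega123 q r x v
  rw [omega123_apply, omega123_apply]
  simp only [omega_zero_apply, omega_one_apply, omega_two_apply, lift_heisMul q hg,
    lift_heisMul r hg, dL_apply]
  simp [heisMul]
  ring

/-- The conjugate coordinate covector. -/
def conjCoord (j : Fin 3) : H3 →L[ℝ] ℂ :=
  (Complex.conjCLE : ℂ →L[ℝ] ℂ).comp (ContinuousLinearMap.proj j)

theorem conjCoord_apply (j : Fin 3) (v : H3) : conjCoord j v = (starRingEnd ℂ) (v j) := rfl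

/-- The constant covector `dz₁ ∧ dz₂ ∧ θ`. -/
def dz12 (θ : H3 →L[ℝ] ℂ) : Cov 3 :=
  wedge (ContinuousLinearMap.proj 0) (wedge (ContinuousLinearMap.proj 1) (wedge θ oneCov))

/-- The term `z₁ dz₂` of `φ³` dies against `dz₂`. What remains is a combination of constant
covectors, so only `dq` and `dr` enter the exterior derivative. -/
theorem omega123_eq (q r : SmoothFun) (x : H3) : omega123 q r x =
    dz12 (ContinuousLinearMap.proj 2) + q.lift x • dz12 (conjCoord 0)
      + r.lift x • dz12 (conjCoord 1) := by
  ext v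
  change _ = dz12 _ v + q.lift x * dz12 _ v + r.lift x * dz12 _ v
  simp only [omega123_apply, omega_zero_apply, omega_one_apply, omega_two_apply, dz12,
    wedge_wedge_wedge_one_apply, ContinuousLinearMap.proj_apply, conjCoord_apply]
  ring

theorem SmoothFun.contDiff_lift (q : SmoothFun) : ContDiff ℝ ∞ q.lift := q.smooth

theorem SmoothFun.differentiable_lift (q : SmoothFun) : Differentiable ℝ q.lift :=
  q.contDiff_lift.differentiable (by simp)

theorem contDiff_omega123 (q r : SmoothFun) : ContDiff ℝ ∞ (omega123 q r) := by
  have e : omega123 q r = fun x => dz12 (ContinuousLinearMap.proj 2)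
      + q.lift x • dz12 (conjCoord 0) + r.lift x • dz12 (conjCoord 1) :=
    funext (omega123_eq q r)
  rw [e]
  exact (contDiff_const.add (q.contDiff_lift.smul contDiff_const)).add
    (r.contDiff_lift.smul contDiff_const)

theorem extDeriv_omega123 (q r : SmoothFun) (x : H3) : extDeriv (omega123 q r) x =
    wedge (fderiv ℝ q.lift x) (dz12 (conjCoord 0)) +
      wedge (fderiv ℝ r.lift x) (dz12 (conjCoord 1)) := by
  have e : omega123 q r = fun x => dz12 (ContinuousLinearMap.proj 2)
      + q.lift x • dz12 (conjCoord 0) + r.lift x • dz12 (conjCoord 1) :=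
    funext (omega123_eq q r)
  have hd : HasFDerivAt (omega123 q r) ((fderiv ℝ q.lift x).smulRight (dz12 (conjCoord 0)) +
      (fderiv ℝ r.lift x).smulRight (dz12 (conjCoord 1))) x := by
    rw [e]
    exact (((q.differentiable_lift x).hasFDerivAt.smul_const _).const_add _).add
      ((r.differentiable_lift x).hasFDerivAt.smul_const (dz12 (conjCoord 1)))
  rw [extDeriv, hd.fderiv, ContinuousAlternatingMap.alternatizeUncurryFin_add]
  rfl

/-- The derivative `∂/∂z₃`. -/
def dz3 (F : H3 → ℂ) (x : H3) : ℂ :=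
  1 / 2 * (fderiv ℝ F x (Pi.single 2 1) - Complex.I * fderiv ℝ F x (Pi.single 2 Complex.I))

/-- Wirtinger decomposition: the coefficients are the `∂/∂zⱼ` and `∂/∂z̄ⱼ` components of `θ`. -/
theorem real_linear_eq (θ : H3 →L[ℝ] ℂ) (v : H3) : θ v =
    ∑ j : Fin 3, (1 / 2 * (θ (Pi.single j 1) - Complex.I * θ (Pi.single j Complex.I)) * v j
      + 1 / 2 * (θ (Pi.single j 1) + Complex.I * θ (Pi.single j Complex.I))
        * (starRingEnd ℂ) (v j)) := by
  have hv : v = ∑ j : Fin 3, ((v j).re • (Pi.single j 1 : H3)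
      + (v j).im • (Pi.single j Complex.I : H3)) := by
    ext i
    fin_cases i <;> simp [Fin.sum_univ_three]
  conv_lhs => rw [hv]
  rw [map_sum]
  refine Finset.sum_congr rfl fun j _ => ?_
  have h1 : v j = (v j).re + (v j).im * Complex.I := (Complex.re_add_im _).symm
  have h2 : (starRingEnd ℂ) (v j) = (v j).re - (v j).im * Complex.I := by
    apply Complex.ext <;> simp
  rw [h2]
  nth_rw 3 [h1]
  simp only [map_add, map_smul, Complex.real_smul]
  linear_combination ((v j).im * θ (Pi.single j Complex.I)) * Complex.I_sq

/-- The `(1,0)`-part of a covector is a multiple of `ω³` modulo `ω¹` and `ω²`. -/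
theorem part10_Jqr (q r : SmoothFun) (x : H3) (θ : H3 →L[ℝ] ℂ) : ∃ a b : ℂ,
    part10 ((Jqr q r).J x) θ =
      (1 / 2 * (θ (Pi.single 2 1) - Complex.I * θ (Pi.single 2 Complex.I))) • omega q r x 2
      + a • (ContinuousLinearMap.proj 0 : H3 →L[ℝ] ℂ)
      + b • (ContinuousLinearMap.proj 1 : H3 →L[ℝ] ℂ) := by
  set A : Fin 3 → ℂ := fun j => 1 / 2 * (θ (Pi.single j 1) - Complex.I * θ (Pi.single j Complex.I))
    with hA
  set B : Fin 3 → ℂ := fun j => 1 / 2 * (θ (Pi.single j 1) + Complex.I * θ (Pi.single j Complex.I))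
    with hB
  have hθ (v : H3) : θ v = ∑ j : Fin 3, (A j * v j + B j * (starRingEnd ℂ) (v j)) :=
    real_linear_eq θ v
  -- Modulo `(0,1)`-covectors, `dz₃` is `ω³ + z₁ dz₂`, and conjugating `ω³` shows that `dz̄₃` is
  -- `-q̄ dz₁ - r̄ dz₂`.
  refine ⟨A 0 - B 2 * (starRingEnd ℂ) (q.lift x),
    A 1 - B 2 * (starRingEnd ℂ) (r.lift x) + A 2 * x 0, ?_⟩
  ext v
  change part10 _ θ v = A 2 * omega q r x 2 v + (A 0 - B 2 * (starRingEnd ℂ) (q.lift x)) * v 0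
    + (A 1 - B 2 * (starRingEnd ℂ) (r.lift x) + A 2 * x 0) * v 1
  have hJ : (Jqr q r).J x v = ![Complex.I * v 0, Complex.I * v 1,
      Complex.I * v 2 + 2 * Complex.I * q.lift x * (starRingEnd ℂ) (v 0) +
        2 * Complex.I * r.lift x * (starRingEnd ℂ) (v 1)] := Jmap_apply _ _ v
  rw [part10_apply, omega_two_apply, hθ, hθ, hJ]
  simp only [Fin.sum_univ_three, Matrix.cons_val_zero, Matrix.cons_val_one, Matrix.cons_val_two,
    Matrix.head_cons, Matrix.tail_cons, map_add, map_mul, Complex.conj_I,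
    Complex.conj_conj, map_ofNat]
  ring_nf
  simp only [Complex.I_sq]
  ring

/-! ### The `(3,1)`-part of `dω^{123}` and the connection form -/

theorem wedge_proj_zero_dz12 (θ : H3 →L[ℝ] ℂ) : wedge (ContinuousLinearMap.proj 0) (dz12 θ) = 0 :=
  wedge_wedge_self _ _

theorem wedge_proj_one_dz12 (θ : H3 →L[ℝ] ℂ) : wedge (ContinuousLinearMap.proj 1) (dz12 θ) = 0 := by
  rw [dz12, wedge_swap, wedge_wedge_self, wedge_zero_right, neg_zero]

theorem wedge_dz12_swap (θ η : H3 →L[ℝ] ℂ) : wedge θ (dz12 η) = -wedge η (dz12 θ) := by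
  have h (ζ ξ : H3 →L[ℝ] ℂ) : wedge ζ (dz12 ξ) = wedge (ContinuousLinearMap.proj 0)
      (wedge (ContinuousLinearMap.proj 1) (wedge ζ (wedge ξ oneCov))) := by
    rw [dz12, wedge_swap ζ, wedge_swap ζ, wedge_neg_right, neg_neg]
  rw [h, h, wedge_swap θ η, wedge_neg_right, wedge_neg_right]

theorem conjCoord_Jqr (q r : SmoothFun) (x v : H3) {j : Fin 3} (hj : j = 0 ∨ j = 1) :
    conjCoord j ((Jqr q r).J x v) = -(Complex.I * conjCoord j v) := by
  rcases hj with rfl | rfl <;> simp [conjCoord_apply, Jqr, Jmap_apply]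

/-- The covector `dz₁ ∧ dz₂ ∧ dz̄ⱼ` has type `(2,1)`, so only the `(1,0)`-part of `θ` matters.
Modulo `dz₁` and `dz₂` that part is a multiple of `ω³`, and exchanging `ω³` with `dz̄ⱼ` gives the
minus sign. -/
theorem typePart_wedge_dz12 (q r : SmoothFun) (x : H3) (θ : H3 →L[ℝ] ℂ) {j : Fin 3}
    (hj : j = 0 ∨ j = 1) :
    typePart ((Jqr q r).J x) 3 (wedge θ (dz12 (conjCoord j))) =
      wedge (-(1 / 2 * (θ (Pi.single 2 1) - Complex.I * θ (Pi.single 2 Complex.I))) • conjCoord j)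
        (omega123 q r x) := by
  have ht : IsType ((Jqr q r).J x) 2 1 (dz12 (conjCoord j)) :=
    (((isType_oneCov _).wedge_of_antilinear fun v => conjCoord_Jqr q r x v hj).wedge_of_linear
      fun v => omega_Jqr q r x v 1).wedge_of_linear fun v => omega_Jqr q r x v 0
  obtain ⟨a, b, hab⟩ := part10_Jqr q r x θ
  have ho : omega123 q r x = dz12 (omega q r x 2) := rfl
  rw [ht.typePart_succ_wedge_add ((Jqr q r).sq x) θ, hab, wedge_add_left, wedge_add_left,
    wedge_smul_left, wedge_smul_left, wedge_smul_left, wedge_proj_zero_dz12, wedge_proj_one_dz12,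
    wedge_dz12_swap, wedge_smul_left, ho]
  module

/-- The connection form of the canonical bundle in the frame `ω^{123}`. -/
def connForm (q r : SmoothFun) (x : H3) : H3 →L[ℝ] ℂ :=
  -dz3 q.lift x • conjCoord 0 + -dz3 r.lift x • conjCoord 1

theorem connForm_apply (q r : SmoothFun) (x v : H3) : connForm q r x v =
    -dz3 q.lift x * (starRingEnd ℂ) (v 0) + -dz3 r.lift x * (starRingEnd ℂ) (v 1) := rfl

theorem connForm_Jqr (q r : SmoothFun) (x v : H3) :
    connForm q r x ((Jqr q r).J x v) = -(Complex.I * connForm q r x v) := by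
  have h0 := conjCoord_Jqr q r x v (Or.inl rfl : (0 : Fin 3) = 0 ∨ (0 : Fin 3) = 1)
  have h1 := conjCoord_Jqr q r x v (Or.inr rfl : (1 : Fin 3) = 0 ∨ (1 : Fin 3) = 1)
  rw [conjCoord_apply, conjCoord_apply] at h0 h1
  rw [connForm_apply, connForm_apply, h0, h1]
  ring

theorem dbarForm_omega123 (q r : SmoothFun) (x : H3) :
    dbarForm (Jqr q r) (omega123 q r) x = wedge (connForm q r x) (omega123 q r x) := by
  rw [dbarForm, extDeriv_omega123, typePart_add, typePart_wedge_dz12 q r x _ (Or.inl rfl),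
    typePart_wedge_dz12 q r x _ (Or.inr rfl), ← wedge_add_left]
  rfl

theorem dbarAlong_omega123 (q r : SmoothFun) (x v : H3) :
    dbarAlong (Jqr q r) (omega123 q r) x v = connForm q r x v • omega123 q r x := by
  rw [dbarAlong, dbarForm_omega123]
  exact (isCanonical_omega123 q r x).contract_wedge (connForm_Jqr q r x) v

/-- Each of the `l` tensor slots contributes the same multiple of `(ω^{123})^{⊗l}`, whence the
factor `l`. -/
theorem dbarPow_omega123 (q r : SmoothFun) (l : ℕ) (f : H3 → ℂ) (x v : H3) :
    dbarPow (Jqr q r) l f (omega123 q r) x v =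
      (dbarFun (Jqr q r) f x v + l * f x * connForm q r x v) • tpow l (omega123 q r x) := by
  have h (j : Fin l) : PiTensorProduct.tprod ℂ (Function.update (fun _ : Fin l => omega123 q r x) j
      (dbarAlong (Jqr q r) (omega123 q r) x v)) =
      connForm q r x v • tpow l (omega123 q r x) := by
    rw [dbarAlong_omega123, MultilinearMap.map_update_smul, Function.update_eq_self, tpow]
  rw [dbarPow]
  simp only [h, Finset.sum_const, Finset.card_univ, Fintype.card_fin]
  rw [← Nat.cast_smul_eq_nsmul ℂ, smul_smul, smul_smul, ← add_smul]
  congr 1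
  ring

theorem dbarPow_omega123_eq_zero_iff (q r : SmoothFun) (l : ℕ) (f : H3 → ℂ) (x v : H3) :
    dbarPow (Jqr q r) l f (omega123 q r) x v = 0 ↔
      dbarFun (Jqr q r) f x v + l * f x * connForm q r x v = 0 := by
  rw [dbarPow_omega123, smul_eq_zero, or_iff_left (tpow_ne_zero l (omega123_ne_zero q r x))]

/-! ### `∂̄` of function multiples of `ω^{123}`, and the fibre of the canonical bundle -/

theorem dbarForm_smul_omega123 (q r : SmoothFun) {f : H3 → ℂ} {x : H3}
    (hf : DifferentiableAt ℝ f x) :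
    dbarForm (Jqr q r) (fun y => f y • omega123 q r y) x =
      wedge (dbarFun (Jqr q r) f x + f x • connForm q r x) (omega123 q r x) := by
  have hω : DifferentiableAt ℝ (omega123 q r) x :=
    (contDiff_omega123 q r).differentiable (by simp) x
  have hd : extDeriv (fun y => f y • omega123 q r y) x =
      f x • extDeriv (omega123 q r) x + wedge (fderiv ℝ f x) (omega123 q r x) := by
    have hd' : HasFDerivAt (fun y => f y • omega123 q r y) (f x • fderiv ℝ (omega123 q r) x +
        (fderiv ℝ f x).smulRight (omega123 q r x)) x := hf.hasFDerivAt.smul hω.hasFDerivAt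
    rw [extDeriv, hd'.fderiv,
      ContinuousAlternatingMap.alternatizeUncurryFin_add,
      ContinuousAlternatingMap.alternatizeUncurryFin_smul]
    rfl
  have ht := (isType_omega123 q r x).typePart_wedge_add ((Jqr q r).sq x) (fderiv ℝ f x)
  have hb := dbarForm_omega123 q r x
  rw [dbarForm] at hb ⊢
  rw [hd, typePart_add, typePart_smul, hb, ht, wedge_add_left, wedge_smul_left, add_comm]
  rfl

/-- The covector `∂̄f + f Γ` has type `(0,1)`, so it is recovered from its wedge with `ω^{123}` by
contraction. -/
theorem dbarForm_smul_omega123_eq_zero (q r : SmoothFun) {f : H3 → ℂ} {x : H3}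
    (hf : DifferentiableAt ℝ f x)
    (h : dbarForm (Jqr q r) (fun y => f y • omega123 q r y) x = 0) (v : H3) :
    dbarFun (Jqr q r) f x v + f x * connForm q r x v = 0 := by
  rw [dbarForm_smul_omega123 q r hf] at h
  have hc := (isCanonical_omega123 q r x).contract_wedge
    (Λ := dbarFun (Jqr q r) f x + f x • connForm q r x) (fun w => by
      have h1 := part01_comp ((Jqr q r).J x) ((Jqr q r).sq x) (fderiv ℝ f x) w
      have h2 := connForm_Jqr q r x w
      change part01 _ (fderiv ℝ f x) _ + f x * connForm q r x _ =
        -(Complex.I * (part01 _ (fderiv ℝ f x) w + f x * connForm q r x w))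
      rw [h1, h2]
      ring) v
  have h0 : (1 / 2 : ℂ) • ((0 : Cov 4).curryLeft v
      + Complex.I • (0 : Cov 4).curryLeft ((Jqr q r).J x v)) = 0 := by
    ext w
    simp
  rw [h, h0] at hc
  exact (smul_eq_zero.mp hc.symm).resolve_right (omega123_ne_zero q r x)

/-- A covector in the fibre of the canonical bundle is a multiple of `ω^{123}`. -/
theorem IsCanonical.eq_smul_omega123 {q r : SmoothFun} {x : H3} {α : Cov 3}
    (h : IsCanonical ((Jqr q r).J x) α) : α = α coordFrame • omega123 q r x := by
  -- This shear carries multiplication by `i` to `J`. Pulling back along it turns canonical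
  -- covectors into complex alternating `3`-forms on `ℂ³`, which are multiples of the determinant.
  let L : H3 →L[ℝ] H3 := ContinuousLinearMap.pi ![ContinuousLinearMap.proj 0,
    ContinuousLinearMap.proj 1,
    ContinuousLinearMap.proj 2 - q.lift x • conjCoord 0 - r.lift x • conjCoord 1]
  have hL (c : H3) : L c = ![c 0, c 1, c 2 - q.lift x * (starRingEnd ℂ) (c 0)
      - r.lift x * (starRingEnd ℂ) (c 1)] := by
    ext i
    fin_cases i <;> rfl
  have hJL (c : H3) : L (Complex.I • c) = (Jqr q r).J x (L c) := by
    change _ = Jmap (q.lift x) (r.lift x) (L c)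
    rw [Jmap_apply, hL, hL]
    ext i
    fin_cases i <;> simp
    ring
  have hsurj (v : H3) : ∃ c, L c = v :=
    ⟨![v 0, v 1, v 2 + q.lift x * (starRingEnd ℂ) (v 0) + r.lift x * (starRingEnd ℂ) (v 1)], by
      rw [hL]
      ext i
      fin_cases i <;> simp
      ring⟩
  have hsmul (z : ℂ) (c : H3) : L (z • c) = z.re • L c + z.im • (Jqr q r).J x (L c) := by
    rw [← hJL, ← map_smul, ← map_smul, ← map_add]
    congr 1
    ext i
    simp [Pi.smul_apply]
    conv_lhs => rw [← Complex.re_add_im z]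
    ring
  let pull (β : Cov 3) (hβ : IsCanonical ((Jqr q r).J x) β) : H3 [⋀^Fin 3]→ₗ[ℂ] ℂ :=
    { toFun := fun v => β fun i => L (v i)
      map_update_add' := by
        intro _ m i y z
        have e (w : H3) : (fun j => L (Function.update m i w j)) =
            Function.update (fun j => L (m j)) i (L w) := by
          ext j : 1
          exact Function.apply_update (fun _ => L) m i w j
        have := Subsingleton.elim ‹DecidableEq (Fin 3)› (instDecidableEqFin 3)
        subst this
        rw [e, e, e, map_add, β.map_update_add]
      map_update_smul' := by
        intro _ m i z y
        have := Subsingleton.elim ‹DecidableEq (Fin 3)› (instDecidableEqFin 3)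
        subst this
        have e (w : H3) : (fun j => L (Function.update m i w j)) =
            Function.update (fun j => L (m j)) i (L w) := by
          ext j : 1
          exact Function.apply_update (fun _ => L) m i w j
        have hc := hβ (Function.update (fun j => L (m j)) i (L y)) i
        rw [Function.update_idem, Function.update_self] at hc
        rw [e, e, hsmul, β.map_update_add, β.map_update_smul, β.map_update_smul, hc]
        conv_rhs => rw [← Complex.re_add_im z]
        simp only [Complex.real_smul, smul_eq_mul]
        ring
      map_eq_zero_of_eq' := by
        intro v i j hij hne
        exact β.map_eq_zero_of_eq _ (by simp only [hij]) hne }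
  have key (β : Cov 3) (hβ : IsCanonical ((Jqr q r).J x) β) (c : Fin 3 → H3) :
      β (fun i => L (c i)) = β (fun i => L (Pi.single i 1)) *
        (Pi.basisFun ℂ (Fin 3)).det c := by
    have := congrArg (fun γ : H3 [⋀^Fin 3]→ₗ[ℂ] ℂ => γ c)
      ((pull β hβ).eq_smul_basis_det (Pi.basisFun ℂ (Fin 3)))
    have e : pull β hβ (Pi.basisFun ℂ (Fin 3)) = β (fun i => L (Pi.single i 1)) := by
      change β (fun i => L (Pi.basisFun ℂ (Fin 3) i)) = _
      simp only [Pi.basisFun_apply]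
    rw [e] at this
    exact this
  have hω := isCanonical_omega123 q r x
  -- Here `d` is the determinant transported through a right inverse of `L`. It does not depend on
  -- `β`, so the coefficients of `α` and `ω^{123}` can be compared on `coordFrame`.
  obtain ⟨d, hd⟩ : ∃ d : (Fin 3 → H3) → ℂ, ∀ (β : Cov 3), IsCanonical ((Jqr q r).J x) β →
      ∀ v, β v = β (fun i => L (Pi.single i 1)) * d v := by
    choose s hs using hsurj
    refine ⟨fun v => (Pi.basisFun ℂ (Fin 3)).det fun i => s (v i), fun β hβ v => ?_⟩
    rw [← key β hβ]
    simp only [hs]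
  have h1 := hd _ hω coordFrame
  rw [omega123_coordFrame] at h1
  ext v
  change α v = α coordFrame * omega123 q r x v
  rw [hd α h v, hd α h coordFrame, hd _ hω v]
  linear_combination (α (fun i => L (Pi.single i 1)) * d v) * h1

/-! ### Lattice-invariant functions -/

/-- The function on the Heisenberg group descends to the Iwasawa manifold. -/
def IsInvariantFun (F : H3 → ℂ) : Prop := ∀ g ∈ lattice, ∀ x, F (heisMul g x) = F x

theorem SmoothFun.isInvariantFun_lift (f : SmoothFun) : IsInvariantFun f.lift :=
  fun _ hg x => lift_heisMul f hg x

theorem one_mem_gaussian : (1 : ℂ) ∈ GaussianInt.toComplex.range := one_mem _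

theorem I_mem_gaussian : Complex.I ∈ GaussianInt.toComplex.range :=
  ⟨⟨0, 1⟩, by simp [GaussianInt.toComplex_def]⟩

theorem single_mem_lattice (j : Fin 3) {n : ℂ} (hn : n ∈ GaussianInt.toComplex.range) :
    (Pi.single j n : H3) ∈ lattice := by
  intro i
  by_cases h : i = j
  · subst h
    simpa using hn
  · rw [Pi.single_eq_of_ne h]
    exact Subring.zero_mem _

theorem IsInvariantFun.add_single_two {F : H3 → ℂ} (hF : IsInvariantFun F) {n : ℂ}
    (hn : n ∈ GaussianInt.toComplex.range) (x : H3) : F (x + Pi.single 2 n) = F x := by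
  rw [← hF _ (single_mem_lattice 2 hn) x]
  congr 1
  ext i
  fin_cases i <;> simp [heisMul, add_comm]

/-- Left translation by a lattice element in the `z₁` direction also shifts `z₃` by `n z₂`, so it is
not a coordinate translation. Independence of `z₃` absorbs this shift. -/
theorem IsInvariantFun.add_single {F : H3 → ℂ} (hF : IsInvariantFun F)
    (h3 : ∀ x w, F (x + Pi.single 2 w) = F x) (j : Fin 3) {n : ℂ}
    (hn : n ∈ GaussianInt.toComplex.range) (x : H3) : F (x + Pi.single j n) = F x := by
  rw [← hF _ (single_mem_lattice j hn) x]
  fin_cases j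
  · rw [← h3 _ (n * x 1)]
    congr 1
    ext i
    fin_cases i <;> simp [heisMul, add_comm]
  · congr 1
    ext i
    fin_cases i <;> simp [heisMul, add_comm]
  · congr 1
    ext i
    fin_cases i <;> simp [heisMul, add_comm]

theorem hasFDerivAt_slice {F : H3 → ℂ} (hd : Differentiable ℝ F) (x : H3) (j : Fin 3) (w : ℂ) :
    HasFDerivAt (fun w => F (x + Pi.single j w))
      ((fderiv ℝ F (x + Pi.single j w)).comp (ContinuousLinearMap.single ℝ (fun _ => ℂ) j)) w := by
  have h1 : HasFDerivAt (fun w : ℂ => x + (Pi.single j w : H3))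
      (ContinuousLinearMap.single ℝ (fun _ => ℂ) j) w :=
    (ContinuousLinearMap.single ℝ (fun _ : Fin 3 => ℂ) j).hasFDerivAt.const_add x
  exact (hd _).hasFDerivAt.comp w h1

theorem fderiv_slice {F : H3 → ℂ} (hd : Differentiable ℝ F) (x : H3) (j : Fin 3) (w u : ℂ) :
    fderiv ℝ (fun w => F (x + Pi.single j w)) w u =
      fderiv ℝ F (x + Pi.single j w) (Pi.single j u) := by
  rw [(hasFDerivAt_slice hd x j w).fderiv]
  rfl

/-- A function that satisfies the Cauchy-Riemann equation along a coordinate for which it is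
periodic does not depend on this coordinate. -/
theorem add_single_eq_of_cauchyRiemann {F : H3 → ℂ} (hd : Differentiable ℝ F) (j : Fin 3)
    (hp : ∀ n ∈ GaussianInt.toComplex.range, ∀ x, F (x + Pi.single j n) = F x)
    (hcr : ∀ x, fderiv ℝ F x (Pi.single j 1) + Complex.I * fderiv ℝ F x (Pi.single j Complex.I) = 0)
    (x : H3) (w : ℂ) : F (x + Pi.single j w) = F x := by
  have h := periodic_eq_of_cauchyRiemann (g := fun w => F (x + Pi.single j w))
    (fun w => (hasFDerivAt_slice hd x j w).differentiableAt)
    (fun z => by simp only [Pi.single_add, ← add_assoc, hp _ one_mem_gaussian])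
    (fun z => by simp only [Pi.single_add, ← add_assoc, hp _ I_mem_gaussian])
    (fun z => by rw [fderiv_slice hd, fderiv_slice hd, hcr]) w 0
  simpa using h

/-- An invariant function whose derivative `∂/∂z₃` is constant along a fibre is itself constant
along this fibre. -/
theorem IsInvariantFun.eq_of_dz3_const {F : H3 → ℂ} (hF : IsInvariantFun F)
    (hd : Differentiable ℝ F) {x : H3} (h : ∀ w, dz3 F (x + Pi.single 2 w) = dz3 F x) (w : ℂ) :
    F (x + Pi.single 2 w) = F x := by
  have h := periodic_eq_of_conj_deriv_const (g := fun w => F (x + Pi.single 2 w))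
    (fun w => (hasFDerivAt_slice hd x 2 w).differentiableAt)
    (fun z => by simp only [Pi.single_add, ← add_assoc, hF.add_single_two one_mem_gaussian])
    (fun z => by simp only [Pi.single_add, ← add_assoc, hF.add_single_two I_mem_gaussian])
    (c := dz3 F x)
    (fun z => by rw [fderiv_slice hd, fderiv_slice hd, ← h z, dz3]; ring) w 0
  simpa using h

theorem fderiv_single_eq_zero {F : H3 → ℂ} (hd : Differentiable ℝ F) {x : H3} {j : Fin 3}
    (h : ∀ w, F (x + Pi.single j w) = F x) (u : ℂ) : fderiv ℝ F x (Pi.single j u) = 0 := by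
  have e := fderiv_slice hd x j 0 u
  simp only [h, Pi.single_zero, add_zero] at e
  rw [← e]
  simp

theorem indepOfZ3_iff (f : SmoothFun) :
    f.IndepOfZ3 ↔ ∀ x w, f.lift (x + Pi.single 2 w) = f.lift x := by
  constructor
  · intro h x w
    have := h (x 0) (x 1) (x 2 + w) (x 2)
    convert this using 2 <;> ext i <;> fin_cases i <;> simp
  · intro h z₁ z₂ z₃ w₃
    rw [← h ![z₁, z₂, z₃] (w₃ - z₃)]
    congr 1
    ext i
    fin_cases i <;> simp

/-! ### Vanishing of pluricanonical sections -/

/-- The `z₃`-fibres carry their standard complex structure. In the `z₁` and `z₂` directions,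
computed next, `J` adds a `z₃`-component involving `q` or `r`. -/
theorem Jqr_single_two (q r : SmoothFun) (x : H3) (c : ℂ) :
    (Jqr q r).J x (Pi.single 2 c) = Pi.single 2 (Complex.I * c) := by
  ext i
  fin_cases i <;> simp [Jqr, Jmap_apply]

theorem Jqr_single_zero (q r : SmoothFun) (x : H3) : (Jqr q r).J x (Pi.single 0 1) =
    Pi.single 0 Complex.I + Pi.single 2 (2 * Complex.I * q.lift x) := by
  ext i
  fin_cases i <;> simp [Jqr, Jmap_apply]

theorem Jqr_single_one (q r : SmoothFun) (x : H3) : (Jqr q r).J x (Pi.single 1 1) =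
    Pi.single 1 Complex.I + Pi.single 2 (2 * Complex.I * r.lift x) := by
  ext i
  fin_cases i <;> simp [Jqr, Jmap_apply]

theorem dbarFun_apply (𝒥 : AlmostComplex) (F : H3 → ℂ) (x v : H3) : dbarFun 𝒥 F x v =
    1 / 2 * (fderiv ℝ F x v + Complex.I * fderiv ℝ F x (𝒥.J x v)) := rfl

/-- The analytic core: Liouville along the fibres, then rigidity of `q` and `r` wherever `F ≠ 0`,
then Liouville in `z₁` and `z₂`. -/
theorem eq_zero_of_dbar_eq_zero {q r : SmoothFun} (h : ¬ q.IndepOfZ3 ∨ ¬ r.IndepOfZ3) {l : ℕ}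
    (hl : 1 ≤ l) {F : H3 → ℂ} (hF : IsInvariantFun F) (hd : Differentiable ℝ F)
    (heq : ∀ x v, dbarFun (Jqr q r) F x v + l * F x * connForm q r x v = 0) (x : H3) :
    F x = 0 := by
  have hl0 : (l : ℂ) ≠ 0 := by exact_mod_cast (by omega : l ≠ 0)
  have h3 : ∀ x w, F (x + Pi.single 2 w) = F x := by
    refine add_single_eq_of_cauchyRiemann hd 2 (fun n hn => hF.add_single_two hn) fun x => ?_
    -- The connection form has no `dz̄₃` component, so the equation in this direction is
    -- Cauchy-Riemann for `F`.
    have e := heq x (Pi.single 2 1)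
    rw [dbarFun_apply, connForm_apply, Jqr_single_two] at e
    simp at e
    exact e
  have hF3 (x : H3) (c : ℂ) : fderiv ℝ F x (Pi.single 2 c) = 0 :=
    fderiv_single_eq_zero hd (h3 x) c
  have hFt (x : H3) (w : ℂ) : fderiv ℝ F (x + Pi.single 2 w) = fderiv ℝ F x := by
    rw [← fderiv_comp_add_right]
    simp only [h3]
  have e0 (x : H3) : 1 / 2 * (fderiv ℝ F x (Pi.single 0 1)
      + Complex.I * fderiv ℝ F x (Pi.single 0 Complex.I)) = l * F x * dz3 q.lift x := by
    have e := heq x (Pi.single 0 1)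
    rw [dbarFun_apply, connForm_apply, Jqr_single_zero, map_add, hF3] at e
    simp at e
    linear_combination e
  have e1 (x : H3) : 1 / 2 * (fderiv ℝ F x (Pi.single 1 1)
      + Complex.I * fderiv ℝ F x (Pi.single 1 Complex.I)) = l * F x * dz3 r.lift x := by
    have e := heq x (Pi.single 1 1)
    rw [dbarFun_apply, connForm_apply, Jqr_single_one, map_add, hF3] at e
    simp at e
    linear_combination e
  have key (s : SmoothFun) (j : Fin 3) (e : ∀ x, 1 / 2 * (fderiv ℝ F x (Pi.single j 1)
      + Complex.I * fderiv ℝ F x (Pi.single j Complex.I)) = l * F x * dz3 s.lift x) :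
      (∀ x, F x ≠ 0 → ∀ w, s.lift (x + Pi.single 2 w) = s.lift x) ∧
      ∀ x w, F (x + Pi.single j w) = F x := by
    -- Along the fibre both `F` and its derivatives are constant. Dividing by `l F` makes `∂s/∂z₃`
    -- constant there.
    have hs (x : H3) (hx : F x ≠ 0) : ∀ w, s.lift (x + Pi.single 2 w) = s.lift x := by
      refine s.isInvariantFun_lift.eq_of_dz3_const s.differentiable_lift fun w => ?_
      have ew := e (x + Pi.single 2 w)
      rw [hFt, h3, e x] at ew
      exact (mul_left_cancel₀ (mul_ne_zero hl0 hx) ew).symm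
    refine ⟨hs, add_single_eq_of_cauchyRiemann hd j (fun n hn => hF.add_single h3 j hn)
      fun x => ?_⟩
    -- The product vanishes at zeros of `F` trivially and elsewhere because `s` is constant on the
    -- fibre. Thus no control of the zero set of `F` is needed.
    have hz : F x * dz3 s.lift x = 0 := by
      by_cases hx : F x = 0
      · rw [hx, zero_mul]
      · have := fderiv_single_eq_zero s.differentiable_lift (hs x hx)
        rw [dz3, this, this]
        ring
    linear_combination 2 * e x + 2 * l * hz
  obtain ⟨hq, hF0⟩ := key q 0 e0
  obtain ⟨hr, hF1⟩ := key r 1 e1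
  by_contra hx
  have hconst (y : H3) : F y = F x := by
    have hy : y = x + Pi.single 0 (y 0 - x 0) + Pi.single 1 (y 1 - x 1)
        + Pi.single 2 (y 2 - x 2) := by
      ext i
      fin_cases i <;> simp
    rw [hy, h3, hF1, hF0]
  rcases h with h | h
  · exact h ((indepOfZ3_iff q).mpr fun y => hq y (by rwa [hconst]))
  · exact h ((indepOfZ3_iff r).mpr fun y => hr y (by rwa [hconst]))

theorem isFrame_omega123 (q r : SmoothFun) : IsFrame (Jqr q r) Set.univ (omega123 q r) where
  smooth := (contDiff_omega123 q r).contDiffOn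
  canonical x _ := isCanonical_omega123 q r x
  ne_zero x _ := omega123_ne_zero q r x

/-- A trivializing `Ω` equals `F ω^{123}` with `F` invariant and smooth, and its closedness is the
scalar equation with `l = 1`. Then `F = 0`, although `Ω` has no zeros. -/
theorem not_pseudoholomorphicallyTrivial_Jqr {q r : SmoothFun}
    (h : ¬ q.IndepOfZ3 ∨ ¬ r.IndepOfZ3) : ¬ PseudoholomorphicallyTrivial (Jqr q r) := by
  rintro ⟨Ω, hinv, hframe, hclosed⟩
  set F : H3 → ℂ := fun x => Ω x coordFrame with hFdef
  have hΩ (x : H3) : Ω x = F x • omega123 q r x :=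
    (hframe.canonical x trivial).eq_smul_omega123
  have hsm : ContDiff ℝ ∞ Ω := contDiffOn_univ.mp hframe.smooth
  have hd : Differentiable ℝ F := by
    have := (ContinuousAlternatingMap.apply ℝ H3 ℂ coordFrame).differentiable.comp
      (hsm.differentiable (by simp))
    exact this
  have hF : IsInvariantFun F := by
    intro g hg x
    have e := hinv g hg x
    rw [hΩ, hΩ, map_smul, isInvariantForm_omega123 q r g hg x] at e
    exact smul_left_injective ℂ (omega123_ne_zero q r x) e
  have hz := eq_zero_of_dbar_eq_zero h le_rfl hF hd (fun x v => by
    have hc := hclosed x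
    rw [funext hΩ] at hc
    rw [Nat.cast_one, one_mul]
    exact dbarForm_smul_omega123_eq_zero q r (hd x) hc v) 0
  exact hframe.ne_zero 0 trivial (by rw [hΩ, hz]; ext v; simp)

/-- Since `ω^{123}` is a frame over the whole covering, testing a section on this single frame
yields a global coefficient. It is lattice-invariant because the frame is. -/
theorem pluri_Jqr_eq_bot {q r : SmoothFun} (h : ¬ q.IndepOfZ3 ∨ ¬ r.IndepOfZ3) {l : ℕ}
    (hl : 1 ≤ l) : pluri (Jqr q r) l = ⊥ := by
  rw [eq_bot_iff]
  rintro s ⟨hinv, hloc⟩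
  obtain ⟨F, hsm, hs, hdbar⟩ := hloc Set.univ (omega123 q r) isOpen_univ (isFrame_omega123 q r)
  have hd : Differentiable ℝ F := (contDiffOn_univ.mp hsm).differentiable (by simp)
  have hF : IsInvariantFun F := by
    intro g hg x
    have e := hinv g hg x
    rw [hs _ trivial, hs _ trivial, map_smul, tpow, PiTensorProduct.map_tprod] at e
    simp only [isInvariantForm_omega123 q r g hg x] at e
    exact smul_left_injective ℂ (tpow_ne_zero l (omega123_ne_zero q r x)) e
  have hz := eq_zero_of_dbar_eq_zero h hl hF hd fun x v =>
    (dbarPow_omega123_eq_zero_iff q r l F x v).mp (hdbar x trivial v)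
  refine (Submodule.mem_bot ℂ).mpr (funext fun x => ?_)
  rw [hs x trivial, hz, zero_smul]
  rfl

end Iwasawa

end

theorem mainTheorem1 (q r : Iwasawa.SmoothFun) (h : ¬ q.IndepOfZ3 ∨ ¬ r.IndepOfZ3) :
    (∀ l : ℕ, 1 ≤ l → ∀ f : Iwasawa.SmoothFun,
      (∀ x v, Iwasawa.dbarPow (Iwasawa.Jqr q r) l f.lift (Iwasawa.omega123 q r) x v = 0) →
        ∀ p : Iwasawa.Manifold, f.toFun p = 0) ∧
    ¬ Iwasawa.PseudoholomorphicallyTrivial (Iwasawa.Jqr q r) ∧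
    Iwasawa.kodairaDim (Iwasawa.Jqr q r) = ⊥ := by
  refine ⟨fun l hl f hf p => ?_, Iwasawa.not_pseudoholomorphicallyTrivial_Jqr h,
    if_pos fun l hl => Iwasawa.pluri_Jqr_eq_bot h hl⟩
  obtain ⟨x, rfl⟩ := Quotient.exists_rep p
  exact Iwasawa.eq_zero_of_dbar_eq_zero h hl f.isInvariantFun_lift f.differentiable_lift
    (fun x v => (Iwasawa.dbarPow_omega123_eq_zero_iff q r l f.lift x v).mp (hf x v)) x
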